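/- **Definitions (domains).** A subset of a poset is directed if it is nonempty and any two of its elements have an upper bound in it; a poset is directed-complete if each directed subset has a least upper bound. Write $x\ll y$ if, for every directed set $S$ having a least upper bound $\bigsqcup S$ with $y\sqsubseteq\bigsqcup S$, there is $s\in S$ with $x\sqsubseteq s$; $x$ is compact if $x\ll x$. A set $B$ is a basis if for every $x$ the set $\{b\in B: b\ll x\}$ contains a directed subset with least upper bound $x$. A domain is a directed-complete poset with a basis; it is algebraic if its compact elements form a basis, and pointed if it has a least element. $\mathbf{DOM}$ is the category of domains and Scott continuous functions (functions preserving all existing least upper bounds of directed sets). $\mathbf{aDOM}$, $\mathbf{DOM}_\bot$, $\mathbf{aDOM}_\bot$ are its full subcategories of algebraic, pointed, and pointed algebraic domains. **Definitions (CF-approximation spaces).** For a binary relation $\Theta$ on a set $U$ and $X\subseteq U$ let $\overline\Theta(X)=\{x\in U:\exists y\in X,\ x\,\Theta\,y\}$. A CF-approximation space is a triple $(U,\Theta,\mathfrak F)$, where $\Theta$ is transitive and $\mathfrak F$ is a family of finite subsets of $U$ such that for all $F\in\mathfrak F$ and all finite $K\subseteq\overline\Theta(F)$ there is $G\in\mathfrak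 F$ with $K\subseteq\overline\Theta(G)$ and $G\subseteq\overline\Theta(F)$. It is topological if $\Theta$ is also reflexive. It satisfies condition (M) if there is $T\in\mathfrak F$ with $T\subseteq\overline\Theta(F)$ for all $F\in\mathfrak F$. A CF-approximable relation from $(U,\Theta,\mathfrak F)$ to $(U',\Theta',\mathfrak F')$ is a relation $\Delta\subseteq\mathfrak F\times\mathfrak F'$ such that for all $F,F'\in\mathfrak F$ and $G,G'\in\mathfrak F'$: 1. there is $\widehat G\in\mathfrak F'$ with $F\,\Delta\,\widehat G$; 2. if $F\subseteq\overline\Theta(F')$ and $F\,\Delta\,G$, then $F'\,\Delta\,G$; 3. if $F\,\Delta\,G$ and $G'\subseteq\overline{\Theta'}(G)$, then $F\,\Delta\,G'$; 4. if $F\,\Delta\,G$, then there are $\widehat F\in\mathfrak F$, $\widehat G\in\mathfrak F'$ with $\widehat F\subseteq\overline\Theta(F)$, $G\subseteq\overline{\Theta'}(\widehat G)$ and $\widehat F\,\Delta\,\widehat G$; 5. if $F\,\Delta\,G$ and $F\,\Delta\,G'$, then there is $\widehat G\in\mathfrak F'$ with $G\cup G'\subseteq\overline{\Theta'}(\widehat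 G)$ and $F\,\Delta\,\widehat G$. CF-approximation spaces and CF-approximable relations form a category $\mathbf{CFA}$ under composition of relations, the identity on $(U,\Theta,\mathfrak F)$ being $\{(F,G): G\subseteq\overline\Theta(F)\}$. $\mathbf{tCFA}$, $\mathbf{CFA}_{(M)}$, $\mathbf{tCFA}_{(M)}$ are its full subcategories of the spaces that are topological, that satisfy (M), and that do both. **Theorem.** The following pairs of categories are equivalent: 1. $\mathbf{tCFA}$ and $\mathbf{aDOM}$; 2. $\mathbf{CFA}_{(M)}$ and $\mathbf{DOM}_\bot$; 3. $\mathbf{tCFA}_{(M)}$ and $\mathbf{aDOM}_\bot$. -/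

import Mathlib

open CategoryTheory

universe u

/-! ### Domains -/

/-- A partial order is directed-complete if every (nonempty) directed subset has a least upper
bound. -/
def IsDirectedComplete (D : Type u) [PartialOrder D] : Prop :=
  ∀ S : Set D, S.Nonempty → DirectedOn (· ≤ ·) S → ∃ a, IsLUB S a

/-- `x` approximates `y` (`x ≪ y`): whenever a directed set has a least upper bound above `y`,
some member of the set is above `x`. -/
def Approximates {D : Type u} [PartialOrder D] (x y : D) : Prop :=
  ∀ S : Set D, S.Nonempty → DirectedOn (· ≤ ·) S →
    ∀ a, IsLUB S a → y ≤ a → ∃ s ∈ S, x ≤ s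

/-- `B` is a basis if for every `x` the set of all `b ∈ B` with `b ≪ x` contains a directed subset
with least upper bound `x`. -/
def IsDomainBasis {D : Type u} [PartialOrder D] (B : Set D) : Prop :=
  ∀ x : D, ∃ S : Set D, S ⊆ {b | b ∈ B ∧ Approximates b x} ∧
    S.Nonempty ∧ DirectedOn (· ≤ ·) S ∧ IsLUB S x

/-- Domains: directed-complete partial orders that have a basis. -/
structure Dom : Type (u + 1) where
  carrier : Type u
  [order : PartialOrder carrier]
  directedComplete : IsDirectedComplete carrier
  exists_basis : ∃ B : Set carrier, IsDomainBasis B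

namespace Dom

instance (D : Dom.{u}) : PartialOrder D.carrier := D.order

/-- Morphisms of domains: Scott continuous functions. -/
@[ext]
structure Hom (D E : Dom.{u}) : Type u where
  toFun : D.carrier → E.carrier
  scottContinuous : ScottContinuous toFun

/-- The category of domains and Scott continuous functions. -/
instance : Category.{u} Dom.{u} where
  Hom D E := Hom D E
  id D := ⟨id, ScottContinuous.id⟩
  comp f g := ⟨g.toFun ∘ f.toFun, f.scottContinuous.comp g.scottContinuous⟩

/-- A domain is algebraic if its compact elements (those with `x ≪ x`) form a basis. -/
def IsAlgebraic : ObjectProperty Dom.{u} := fun D =>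
  IsDomainBasis {x : D.carrier | Approximates x x}

/-- A domain is pointed if it has a least element. -/
def IsPointed : ObjectProperty Dom.{u} := fun D =>
  ∃ b : D.carrier, ∀ x : D.carrier, b ≤ x

end Dom

/-! ### CF-approximation spaces -/

/-- The upper approximation of `X` with respect to a binary relation `Θ`: all `x` such that
`{y | Θ x y}` meets `X`. -/
def upperApprox {U : Type u} (Θ : U → U → Prop) (X : Set U) : Set U :=
  {x | ({y | Θ x y} ∩ X).Nonempty}

/-- Generalized approximation spaces with consistent family of finite subsets: a set with a
transitive relation `Θ` and a family `𝔉` of finite subsets satisfying condition (CF). -/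
structure CFSpace : Type (u + 1) where
  carrier : Type u
  Θ : carrier → carrier → Prop
  trans : ∀ x y z, Θ x y → Θ y z → Θ x z
  𝔉 : Set (Finset carrier)
  cf : ∀ F ∈ 𝔉, ∀ K : Finset carrier, (K : Set carrier) ⊆ upperApprox Θ (F : Set carrier) →
    ∃ G ∈ 𝔉, (K : Set carrier) ⊆ upperApprox Θ (G : Set carrier) ∧
      (G : Set carrier) ⊆ upperApprox Θ (F : Set carrier)

namespace CFSpace

/-- The upper approximation operator of the space, restricted to members of `𝔉`. -/
def upper (U : CFSpace.{u}) (F : U.𝔉) : Set U.carrier :=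
  upperApprox U.Θ (F.1 : Set U.carrier)

/-- The underlying set of a member of `𝔉`. -/
def toSet (U : CFSpace.{u}) (F : U.𝔉) : Set U.carrier := (F.1 : Set U.carrier)

/-- CF-approximable relations between CF-approximation spaces. -/
@[ext]
structure Hom (U V : CFSpace.{u}) : Type u where
  rel : U.𝔉 → V.𝔉 → Prop
  total : ∀ F, ∃ G, rel F G
  mono_left : ∀ F F' G, U.toSet F ⊆ U.upper F' → rel F G → rel F' G
  mono_right : ∀ F G G', rel F G → V.toSet G' ⊆ V.upper G → rel F G'
  interpolate : ∀ F G, rel F G →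
    ∃ F₁ G₁, U.toSet F₁ ⊆ U.upper F ∧ V.toSet G ⊆ V.upper G₁ ∧ rel F₁ G₁
  directed : ∀ F G G', rel F G → rel F G' →
    ∃ G₁, V.toSet G ∪ V.toSet G' ⊆ V.upper G₁ ∧ rel F G₁

theorem upper_mono (U : CFSpace.{u}) {F G : U.𝔉} (h : U.toSet F ⊆ U.upper G) :
    U.upper F ⊆ U.upper G := by
  rintro x ⟨y, hxy, hy⟩
  obtain ⟨z, hyz, hz⟩ := h hy
  exact ⟨z, U.trans x y z hxy hyz, hz⟩

theorem exists_interpolant (U : CFSpace.{u}) (F : U.𝔉) (K : Finset U.carrier)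
    (h : (K : Set U.carrier) ⊆ U.upper F) :
    ∃ G : U.𝔉, (K : Set U.carrier) ⊆ U.upper G ∧ U.toSet G ⊆ U.upper F := by
  obtain ⟨G, hG, h₁, h₂⟩ := U.cf F.1 F.2 K h
  exact ⟨⟨G, hG⟩, h₁, h₂⟩

/-- The identity relation: `F` is related to `G` iff `G` is contained in the upper approximation
of `F`. -/
def Hom.id (U : CFSpace.{u}) : Hom U U where
  rel F G := U.toSet G ⊆ U.upper F
  total F := by
    obtain ⟨G, -, h⟩ := U.exists_interpolant F ∅ (by simp)
    exact ⟨G, h⟩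
  mono_left _ _ _ h hG := hG.trans (U.upper_mono h)
  mono_right _ _ _ hG h := h.trans (U.upper_mono hG)
  interpolate F G h := by
    obtain ⟨E, h₁, h₂⟩ := U.exists_interpolant F G.1 h
    obtain ⟨E', h₃, h₄⟩ := U.exists_interpolant E G.1 h₁
    exact ⟨E, E', h₂, h₃, h₄⟩
  directed F G G' h h' := by
    classical
    obtain ⟨E, h₁, h₂⟩ := U.exists_interpolant F (G.1 ∪ G'.1)
      (by rw [Finset.coe_union]; exact Set.union_subset h h')
    exact ⟨E, by rw [Finset.coe_union] at h₁; exact h₁, h₂⟩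

/-- Composition of CF-approximable relations is composition of relations. -/
def Hom.comp {U V W : CFSpace.{u}} (Δ : Hom U V) (Ω : Hom V W) : Hom U W where
  rel F G := ∃ E, Δ.rel F E ∧ Ω.rel E G
  total F := by
    obtain ⟨E, hE⟩ := Δ.total F
    obtain ⟨G, hG⟩ := Ω.total E
    exact ⟨G, E, hE, hG⟩
  mono_left F F' G h := fun ⟨E, h₁, h₂⟩ => ⟨E, Δ.mono_left F F' E h h₁, h₂⟩
  mono_right F G G' := fun ⟨E, h₁, h₂⟩ h => ⟨E, h₁, Ω.mono_right E G G' h₂ h⟩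
  interpolate F G := fun ⟨E, h₁, h₂⟩ => by
    obtain ⟨F₁, E₁, hF, hE, hΔ⟩ := Δ.interpolate F E h₁
    obtain ⟨E₂, G₁, hE', hG, hΩ⟩ := Ω.interpolate E G h₂
    exact ⟨F₁, G₁, hF, hG, E, Δ.mono_right F₁ E₁ E hΔ hE, Ω.mono_left E₂ E G₁ hE' hΩ⟩
  directed F G G' := fun ⟨E, h₁, h₂⟩ ⟨E', h₁', h₂'⟩ => by
    obtain ⟨E₁, hE, hΔ⟩ := Δ.directed F E E' h₁ h₁'
    obtain ⟨G₁, hG, hΩ⟩ := Ω.directed E₁ G G'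
      (Ω.mono_left E E₁ G (Set.subset_union_left.trans hE) h₂)
      (Ω.mono_left E' E₁ G' (Set.subset_union_right.trans hE) h₂')
    exact ⟨G₁, hG, E₁, hΔ, hΩ⟩

theorem Hom.id_comp {U V : CFSpace.{u}} (Δ : Hom U V) : (Hom.id U).comp Δ = Δ := by
  ext F G
  constructor
  · rintro ⟨E, h, hE⟩
    exact Δ.mono_left E F G h hE
  · intro h
    obtain ⟨F₁, G₁, hF, hG, hΔ⟩ := Δ.interpolate F G h
    exact ⟨F₁, hF, Δ.mono_right F₁ G₁ G hΔ hG⟩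

theorem Hom.comp_id {U V : CFSpace.{u}} (Δ : Hom U V) : Δ.comp (Hom.id V) = Δ := by
  ext F G
  constructor
  · rintro ⟨E, hE, h⟩
    exact Δ.mono_right F E G hE h
  · intro h
    obtain ⟨F₁, G₁, hF, hG, hΔ⟩ := Δ.interpolate F G h
    exact ⟨G₁, Δ.mono_left F₁ F G₁ hF hΔ, hG⟩

theorem Hom.assoc {U V W X : CFSpace.{u}} (Δ : Hom U V) (Ω : Hom V W) (Γ : Hom W X) :
    (Δ.comp Ω).comp Γ = Δ.comp (Ω.comp Γ) := by
  ext F G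
  constructor
  · rintro ⟨E, ⟨E', h₁, h₂⟩, h₃⟩
    exact ⟨E', h₁, E, h₂, h₃⟩
  · rintro ⟨E, h₁, E', h₂, h₃⟩
    exact ⟨E', ⟨E, h₁, h₂⟩, h₃⟩

/-- The category of CF-approximation spaces and CF-approximable relations. -/
instance : Category.{u} CFSpace.{u} where
  Hom U V := Hom U V
  id U := Hom.id U
  comp Δ Ω := Hom.comp Δ Ω
  id_comp Δ := Hom.id_comp Δ
  comp_id Δ := Hom.comp_id Δ
  assoc Δ Ω Γ := Hom.assoc Δ Ω Γ

/-- A CF-approximation space is topological if its relation is reflexive. -/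
def IsTopological : ObjectProperty CFSpace.{u} := fun U => ∀ x, U.Θ x x

/-- Condition (M): some member of `𝔉` is contained in the upper approximation of every member. -/
def ConditionM : ObjectProperty CFSpace.{u} := fun U =>
  ∃ T : U.𝔉, ∀ F : U.𝔉, U.toSet T ⊆ U.upper F

end CFSpace

/-- Topological CF-approximation spaces. -/
abbrev TCFA : Type (u + 1) := (CFSpace.IsTopological.{u}).FullSubcategory

/-- CF-approximation spaces with condition (M). -/
abbrev CFAM : Type (u + 1) := (CFSpace.ConditionM.{u}).FullSubcategory

/-- Topological CF-approximation spaces with condition (M). -/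
abbrev TCFAM : Type (u + 1) :=
  ObjectProperty.FullSubcategory
    (fun U : CFSpace.{u} => CFSpace.IsTopological U ∧ CFSpace.ConditionM U)

/-- Algebraic domains. -/
abbrev ADom : Type (u + 1) := (Dom.IsAlgebraic.{u}).FullSubcategory

/-- Pointed domains. -/
abbrev PDom : Type (u + 1) := (Dom.IsPointed.{u}).FullSubcategory

/-- Pointed algebraic domains. -/
abbrev APDom : Type (u + 1) :=
  ObjectProperty.FullSubcategory
    (fun D : Dom.{u} => Dom.IsAlgebraic D ∧ Dom.IsPointed D)

/-! A CF-approximation space is an abstract basis: the relation `Below` on its family is transitive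
and, by condition (CF), has interpolation, so its rounded ideals form a domain. This gives a functor
`idealFunctor` to domains. It is faithful because a relation can be read off from the images of
principal ideals (`mem_map_principal`), and full because a Scott continuous function is determined
by its values there (`mem_apply_iff`, `map_toRel`). Conversely, any basis of a domain, with the
approximation relation and the family of singletons, is a CF-approximation space whose rounded
ideals correspond to the points of the domain (`idealDomBasisSpaceIso`). Reflexivity of the relation
matches compactness of the basis elements, and (M) matches a least element. Each equivalence is then
a restriction of this one functor. -/

/-! ### The approximation relation on a partial order -/

section Approximation

variable {D : Type u} [PartialOrder D] {a b x y : D} {B : Set D}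

theorem Approximates.le (h : Approximates x y) : x ≤ y := by
  obtain ⟨s, hs, hxs⟩ := h {y} (Set.singleton_nonempty y)
    (fun a ha b hb => ⟨y, rfl, le_of_eq ha, le_of_eq hb⟩) y isLUB_singleton le_rfl
  exact hxs.trans (le_of_eq hs)

theorem Approximates.mono (hab : a ≤ b) (h : Approximates b x) (hxy : x ≤ y) :
    Approximates a y := fun S hS hdS z hz hyz =>
  let ⟨s, hs, hbs⟩ := h S hS hdS z hz (hxy.trans hyz)
  ⟨s, hs, hab.trans hbs⟩

theorem IsDomainBasis.mono {B' : Set D} (hB : IsDomainBasis B) (h : B ⊆ B') :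
    IsDomainBasis B' := fun x =>
  let ⟨S, hS, hrest⟩ := hB x
  ⟨S, fun _ hb => ⟨h (hS hb).1, (hS hb).2⟩, hrest⟩

namespace IsDomainBasis

variable (hB : IsDomainBasis B)
include hB

theorem exists_approximates (x : D) : ∃ b ∈ B, Approximates b x :=
  let ⟨_, hS, ⟨b, hb⟩, _⟩ := hB x
  ⟨b, hS hb⟩

theorem exists_upper_bound (ha : Approximates a x) (hb : Approximates b x) :
    ∃ c ∈ B, Approximates c x ∧ a ≤ c ∧ b ≤ c := by
  obtain ⟨S, hS, hne, hdir, hlub⟩ := hB x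
  obtain ⟨s, hs, has⟩ := ha S hne hdir x hlub le_rfl
  obtain ⟨t, ht, hbt⟩ := hb S hne hdir x hlub le_rfl
  obtain ⟨c, hc, hsc, htc⟩ := hdir s hs t ht
  exact ⟨c, (hS hc).1, (hS hc).2, has.trans hsc, hbt.trans htc⟩

theorem le_of_forall (h : ∀ b ∈ B, Approximates b x → b ≤ y) : x ≤ y := by
  obtain ⟨S, hS, -, -, hlub⟩ := hB x
  exact hlub.2 fun b hb => h b (hS hb).1 (hS hb).2

/-- Interpolation: the elements two approximation steps below `x`, through a basis element, form a
directed set with supremum `x`, so `a` lies under one of them. -/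
theorem exists_between (ha : Approximates a x) :
    ∃ c ∈ B, Approximates a c ∧ Approximates c x := by
  let A : Set D := {b | ∃ c ∈ B, Approximates b c ∧ Approximates c x}
  have hne : A.Nonempty := by
    obtain ⟨c, hc, hcx⟩ := hB.exists_approximates x
    obtain ⟨b, -, hbc⟩ := hB.exists_approximates c
    exact ⟨b, c, hc, hbc, hcx⟩
  have hdir : DirectedOn (· ≤ ·) A := by
    rintro b₁ ⟨c₁, -, hb₁, hc₁⟩ b₂ ⟨c₂, -, hb₂, hc₂⟩
    obtain ⟨c, hc, hcx, h₁, h₂⟩ := hB.exists_upper_bound hc₁ hc₂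
    obtain ⟨b, -, hbc, h₁', h₂'⟩ :=
      hB.exists_upper_bound (hb₁.mono le_rfl h₁) (hb₂.mono le_rfl h₂)
    exact ⟨b, ⟨c, hc, hbc, hcx⟩, h₁', h₂'⟩
  have hlub : IsLUB A x := by
    constructor
    · rintro b ⟨c, -, hbc, hcx⟩
      exact hbc.le.trans hcx.le
    · intro z hz
      exact hB.le_of_forall fun c hc hcx => hB.le_of_forall fun b _ hbc => hz ⟨c, hc, hbc, hcx⟩
  obtain ⟨b, ⟨c, hc, hbc, hcx⟩, hab⟩ := ha A hne hdir x hlub le_rfl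
  exact ⟨c, hc, hbc.mono hab le_rfl, hcx⟩

/-- This is what yields condition (CF) for `basisSpace`. -/
theorem exists_between_finset (K : Finset D) (hK : ∀ k ∈ K, Approximates k x) :
    ∃ c ∈ B, (∀ k ∈ K, Approximates k c) ∧ Approximates c x := by
  classical
  induction K using Finset.induction_on with
  | empty =>
    obtain ⟨c, hc, hcx⟩ := hB.exists_approximates x
    exact ⟨c, hc, by simp, hcx⟩
  | insert a K _ ih =>
    obtain ⟨c₁, -, h₁, hc₁⟩ := ih fun k hk => hK k (Finset.mem_insert_of_mem hk)
    obtain ⟨c₂, -, h₂, hc₂⟩ := hB.exists_between (hK a (Finset.mem_insert_self a K))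
    obtain ⟨c, hc, hcx, hl₁, hl₂⟩ := hB.exists_upper_bound hc₁ hc₂
    refine ⟨c, hc, fun k hk => ?_, hcx⟩
    rcases Finset.mem_insert.1 hk with rfl | hk
    · exact h₂.mono le_rfl hl₂
    · exact (h₁ k hk).mono le_rfl hl₁

end IsDomainBasis

theorem OrderIso.scottContinuous_toFun {E : Type u} [PartialOrder E] (e : D ≃o E) :
    ScottContinuous e :=
  fun _ _ _ _ h => e.isLUB_image'.2 h

end Approximation

/-- An order isomorphism between domains is an isomorphism of domains. -/
def Dom.isoOfOrderIso {D E : Dom.{u}} (e : D.carrier ≃o E.carrier) : D ≅ E where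
  hom := (⟨e, e.scottContinuous_toFun⟩ : Dom.Hom D E)
  inv := (⟨e.symm, e.symm.scottContinuous_toFun⟩ : Dom.Hom E D)
  hom_inv_id := Dom.Hom.ext (funext e.symm_apply_apply)
  inv_hom_id := Dom.Hom.ext (funext e.apply_symm_apply)

/-! ### The domain of rounded ideals of a CF-approximation space -/

namespace CFSpace

/-- `U.Below G F` says that `G` is contained in the upper approximation of `F`. -/
def Below (U : CFSpace.{u}) (G F : U.𝔉) : Prop := U.toSet G ⊆ U.upper F

theorem Below.trans {U : CFSpace.{u}} {F G H : U.𝔉} (h : U.Below F G) (h' : U.Below G H) :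
    U.Below F H :=
  Set.Subset.trans h (U.upper_mono h')

/-- Rounded ideals of the members of `𝔉`, ordered by `Below`. -/
structure RoundedIdeal (U : CFSpace.{u}) : Type u where
  mems : Set U.𝔉
  nonempty : mems.Nonempty
  lower : ∀ F G, U.Below F G → G ∈ mems → F ∈ mems
  directed : ∀ F ∈ mems, ∀ G ∈ mems, ∃ H ∈ mems, U.Below F H ∧ U.Below G H

namespace RoundedIdeal

variable {U V W : CFSpace.{u}}

theorem mems_injective : Function.Injective (mems : RoundedIdeal U → Set U.𝔉) := by
  rintro ⟨I, _, _, _⟩ ⟨J, _, _, _⟩ h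
  cases h
  rfl

instance : PartialOrder (RoundedIdeal U) := PartialOrder.lift mems mems_injective

theorem exists_above (I : RoundedIdeal U) {F : U.𝔉} (hF : F ∈ I.mems) :
    ∃ H ∈ I.mems, U.Below F H :=
  let ⟨H, hH, h, _⟩ := I.directed F hF F hF
  ⟨H, hH, h⟩

/-- The rounded ideal of all members of `𝔉` below `F`. -/
def principal (F : U.𝔉) : RoundedIdeal U where
  mems := {G | U.Below G F}
  nonempty := (Hom.id U).total F
  lower _ _ h h' := Below.trans h h'
  directed G hG G' hG' := by
    obtain ⟨H, h, hH⟩ := (Hom.id U).directed F G G' hG hG'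
    exact ⟨H, hH, Set.subset_union_left.trans h, Set.subset_union_right.trans h⟩

theorem mem_principal {F G : U.𝔉} : G ∈ (principal F).mems ↔ U.Below G F := Iff.rfl

theorem principal_mono {F G : U.𝔉} (h : U.Below F G) : principal F ≤ principal G :=
  fun _ hH => Below.trans hH h

theorem principal_le {I : RoundedIdeal U} {F : U.𝔉} (hF : F ∈ I.mems) : principal F ≤ I :=
  fun _ hG => I.lower _ _ hG hF

/-- The union of a directed set of rounded ideals. -/
def union (S : Set (RoundedIdeal U)) (hne : S.Nonempty) (hdir : DirectedOn (· ≤ ·) S) :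
    RoundedIdeal U where
  mems := {F | ∃ I ∈ S, F ∈ I.mems}
  nonempty := by
    obtain ⟨I, hI⟩ := hne
    obtain ⟨F, hF⟩ := I.nonempty
    exact ⟨F, I, hI, hF⟩
  lower F G h := fun ⟨I, hI, hG⟩ => ⟨I, hI, I.lower F G h hG⟩
  directed := by
    rintro F ⟨I, hI, hF⟩ G ⟨J, hJ, hG⟩
    obtain ⟨K, hK, hIK, hJK⟩ := hdir I hI J hJ
    obtain ⟨H, hH, h⟩ := K.directed F (hIK hF) G (hJK hG)
    exact ⟨H, ⟨K, hK, hH⟩, h⟩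

theorem isLUB_union (S : Set (RoundedIdeal U)) (hne : S.Nonempty)
    (hdir : DirectedOn (· ≤ ·) S) : IsLUB S (union S hne hdir) :=
  ⟨fun I hI _ hF => ⟨I, hI, hF⟩, fun _ hJ _ ⟨_, hI, hF⟩ => hJ hI hF⟩

theorem mem_of_isLUB {S : Set (RoundedIdeal U)} (hne : S.Nonempty)
    (hdir : DirectedOn (· ≤ ·) S) {I : RoundedIdeal U} (h : IsLUB S I) {F : U.𝔉} :
    F ∈ I.mems ↔ ∃ J ∈ S, F ∈ J.mems := by
  rw [h.unique (isLUB_union S hne hdir)]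
  rfl

/-- Directed suprema are unions, so the single member `F` already lies in some ideal of the directed
set, which then contains `principal F`. -/
theorem approximates_of_le_principal {I J : RoundedIdeal U} {F : U.𝔉} (hF : F ∈ J.mems)
    (h : I ≤ principal F) : Approximates I J := by
  intro S hne hdir K hK hJK
  obtain ⟨L, hL, hFL⟩ := (mem_of_isLUB hne hdir hK).1 (hJK hF)
  exact ⟨L, hL, h.trans (principal_le hFL)⟩

theorem nonempty_principals (I : RoundedIdeal U) : (principal '' I.mems).Nonempty :=
  I.nonempty.image _

theorem directedOn_principals (I : RoundedIdeal U) :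
    DirectedOn (· ≤ ·) (principal '' I.mems) := by
  rintro _ ⟨F, hF, rfl⟩ _ ⟨G, hG, rfl⟩
  obtain ⟨H, hH, h, h'⟩ := I.directed F hF G hG
  exact ⟨_, ⟨H, hH, rfl⟩, principal_mono h, principal_mono h'⟩

theorem isLUB_principals (I : RoundedIdeal U) : IsLUB (principal '' I.mems) I := by
  constructor
  · rintro _ ⟨F, hF, rfl⟩
    exact principal_le hF
  · intro J hJ F hF
    -- Without reflexivity `F` need not lie in `principal F`; roundedness provides a `G` in `I` with
    -- `F` in `principal G`.
    obtain ⟨G, hG, h⟩ := I.exists_above hF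
    exact hJ ⟨G, hG, rfl⟩ h

theorem isDomainBasis_range_principal :
    IsDomainBasis (Set.range (principal : U.𝔉 → RoundedIdeal U)) := fun I =>
  ⟨principal '' I.mems, by
    rintro _ ⟨F, hF, rfl⟩
    exact ⟨⟨F, rfl⟩, approximates_of_le_principal hF le_rfl⟩,
    I.nonempty_principals, I.directedOn_principals, I.isLUB_principals⟩

/-- The image of a rounded ideal under a CF-approximable relation. -/
def map (Δ : Hom U V) (I : RoundedIdeal U) : RoundedIdeal V where
  mems := {G | ∃ F ∈ I.mems, Δ.rel F G}
  nonempty := by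
    obtain ⟨F, hF⟩ := I.nonempty
    obtain ⟨G, hG⟩ := Δ.total F
    exact ⟨G, F, hF, hG⟩
  lower G G' h := fun ⟨F, hF, hG⟩ => ⟨F, hF, Δ.mono_right F G' G hG h⟩
  directed := by
    rintro G ⟨F, hF, hG⟩ G' ⟨F', hF', hG'⟩
    obtain ⟨E, hE, h, h'⟩ := I.directed F hF F' hF'
    obtain ⟨H, hH, hEH⟩ := Δ.directed E G G' (Δ.mono_left F E G h hG) (Δ.mono_left F' E G' h' hG')
    exact ⟨H, ⟨E, hE, hEH⟩, Set.subset_union_left.trans hH, Set.subset_union_right.trans hH⟩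

theorem scottContinuous_map (Δ : Hom U V) : ScottContinuous (map Δ) := by
  intro S hne hdir I hI
  constructor
  · rintro _ ⟨J, hJ, rfl⟩ G ⟨F, hF, hG⟩
    exact ⟨F, hI.1 hJ hF, hG⟩
  · rintro K hK G ⟨F, hF, hG⟩
    obtain ⟨J, hJ, hFJ⟩ := (mem_of_isLUB hne hdir hI).1 hF
    exact hK ⟨J, hJ, rfl⟩ ⟨F, hFJ, hG⟩

theorem map_id (I : RoundedIdeal U) : map (Hom.id U) I = I := by
  apply mems_injective
  ext G
  exact ⟨fun ⟨F, hF, h⟩ => I.lower G F h hF, fun hG => I.exists_above hG⟩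

theorem map_comp (Δ : Hom U V) (Ω : Hom V W) (I : RoundedIdeal U) :
    map (Δ.comp Ω) I = map Ω (map Δ I) := by
  apply mems_injective
  ext G
  exact ⟨fun ⟨F, hF, E, h, h'⟩ => ⟨E, ⟨F, hF, h⟩, h'⟩, fun ⟨E, ⟨F, hF, h⟩, h'⟩ => ⟨F, hF, E, h, h'⟩⟩

/-- This gives faithfulness. As `F` may be missing from `principal F`, the reverse direction relies
on `interpolate`. -/
theorem mem_map_principal (Δ : Hom U V) (F : U.𝔉) (G : V.𝔉) :
    G ∈ (map Δ (principal F)).mems ↔ Δ.rel F G := by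
  constructor
  · rintro ⟨E, hE, hG⟩
    exact Δ.mono_left E F G hE hG
  · intro h
    obtain ⟨F₁, G₁, hF, hG, h₁⟩ := Δ.interpolate F G h
    exact ⟨F₁, hF, Δ.mono_right F₁ G₁ G h₁ hG⟩

/-- `I` is the directed supremum of the principal ideals of its members; `f` preserves it, and
suprema of ideals are unions. -/
theorem mem_apply_iff {f : RoundedIdeal U → RoundedIdeal V} (hf : ScottContinuous f)
    (I : RoundedIdeal U) (G : V.𝔉) :
    G ∈ (f I).mems ↔ ∃ F ∈ I.mems, G ∈ (f (principal F)).mems := by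
  have hlub := hf I.nonempty_principals I.directedOn_principals I.isLUB_principals
  have hdir : DirectedOn (· ≤ ·) (f '' (principal '' I.mems)) := by
    rintro _ ⟨J, hJ, rfl⟩ _ ⟨K, hK, rfl⟩
    obtain ⟨L, hL, h, h'⟩ := I.directedOn_principals J hJ K hK
    exact ⟨f L, ⟨L, hL, rfl⟩, hf.monotone h, hf.monotone h'⟩
  rw [mem_of_isLUB (I.nonempty_principals.image f) hdir hlub]
  simp

/-- The CF-approximable relation induced by a Scott continuous function. -/
def toRel (f : RoundedIdeal U → RoundedIdeal V) (hf : ScottContinuous f) : Hom U V where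
  rel F G := G ∈ (f (principal F)).mems
  total F := (f (principal F)).nonempty
  mono_left _ _ _ h hG := hf.monotone (principal_mono h) hG
  mono_right F G G' hG h := (f (principal F)).lower G' G h hG
  -- Here preservation of directed suprema is needed; monotonicity alone would not suffice.
  interpolate F G hG := by
    obtain ⟨F₁, hF₁, hG'⟩ := (mem_apply_iff hf _ G).1 hG
    obtain ⟨G₁, hG₁, h⟩ := (f (principal F₁)).exists_above hG'
    exact ⟨F₁, G₁, hF₁, h, hG₁⟩
  directed F G G' hG hG' := by
    obtain ⟨H, hH, h, h'⟩ := (f (principal F)).directed G hG G' hG'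
    exact ⟨H, Set.union_subset h h', hH⟩

theorem map_toRel (f : RoundedIdeal U → RoundedIdeal V) (hf : ScottContinuous f) :
    map (toRel f hf) = f := by
  funext I
  apply mems_injective
  ext G
  exact (mem_apply_iff hf I G).symm

end RoundedIdeal

/-! ### The fully faithful functor to domains. -/

open RoundedIdeal

/-- The domain of rounded ideals of a CF-approximation space. -/
def idealDom (U : CFSpace.{u}) : Dom.{u} where
  carrier := RoundedIdeal U
  directedComplete S hne hdir := ⟨_, isLUB_union S hne hdir⟩
  exists_basis := ⟨_, isDomainBasis_range_principal⟩

/-- The functor sending a CF-approximation space to its domain of rounded ideals. -/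
def idealFunctor : CFSpace.{u} ⥤ Dom.{u} where
  obj := idealDom
  map {U V} Δ := (⟨map Δ, scottContinuous_map Δ⟩ : Dom.Hom (idealDom U) (idealDom V))
  map_id _ := Dom.Hom.ext (funext map_id)
  map_comp Δ Ω := Dom.Hom.ext (funext (map_comp Δ Ω))

instance : idealFunctor.{u}.Faithful where
  map_injective {U V Δ Δ'} h := by
    have h' : map Δ = map Δ' := congrArg Dom.Hom.toFun h
    refine Hom.ext (funext fun F => funext fun G => propext ?_)
    rw [← mem_map_principal, ← mem_map_principal, h']

instance : idealFunctor.{u}.Full where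
  map_surjective f :=
    ⟨toRel (Dom.Hom.toFun f) (Dom.Hom.scottContinuous f),
      Dom.Hom.ext (map_toRel (Dom.Hom.toFun f) (Dom.Hom.scottContinuous f))⟩

/-- Reflexivity puts `F` into `principal F`, which makes every principal ideal compact, and these
form a basis. -/
theorem isAlgebraic_idealDom {U : CFSpace.{u}} (hU : U.IsTopological) :
    U.idealDom.IsAlgebraic := by
  refine (isDomainBasis_range_principal (U := U)).mono ?_
  rintro _ ⟨F, rfl⟩
  exact approximates_of_le_principal (mem_principal.2 fun x hx => ⟨x, hU x, hx⟩) le_rfl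

theorem isPointed_idealDom {U : CFSpace.{u}} (hU : U.ConditionM) : U.idealDom.IsPointed := by
  obtain ⟨T, hT⟩ := hU
  refine ⟨principal T, fun I => ?_⟩
  obtain ⟨F, hF⟩ := RoundedIdeal.nonempty I
  exact principal_le (RoundedIdeal.lower I T F (hT F) hF)

end CFSpace

/-! ### The CF-approximation space of a basis of a domain -/

namespace Dom

variable {D : Dom.{u}} {B : Set D.carrier} (hB : IsDomainBasis B)

theorem mem_upperApprox_singleton {U : Type u} (Θ : U → U → Prop) (x y : U) :
    x ∈ upperApprox Θ (({y} : Finset U) : Set U) ↔ Θ x y := by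
  simp [upperApprox, Set.Nonempty]

/-- A basis with the approximation relation and the family of all singletons. -/
def basisSpace : CFSpace.{u} where
  carrier := B
  Θ a b := Approximates a.1 b.1
  trans _ _ _ h h' := h.mono le_rfl h'.le
  𝔉 := Set.range fun b : B => {b}
  cf := by
    classical
    rintro _ ⟨b, rfl⟩ K hK
    obtain ⟨c, hc, hKc, hcb⟩ := hB.exists_between_finset (K.image Subtype.val) (x := b.1) (by
      intro k hk
      obtain ⟨a, ha, rfl⟩ := Finset.mem_image.1 hk
      exact (mem_upperApprox_singleton _ a b).1 (hK ha))
    refine ⟨{⟨c, hc⟩}, ⟨⟨c, hc⟩, rfl⟩, fun a ha => ?_, fun a ha => ?_⟩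
    · exact (mem_upperApprox_singleton _ _ _).2 (hKc a.1 (Finset.mem_image_of_mem _ ha))
    · obtain rfl : a = ⟨c, hc⟩ := by simpa using ha
      exact (mem_upperApprox_singleton _ _ _).2 hcb

/-- The singleton of a basis element, as a member of the family of the basis space. -/
def basisSingleton (b : B) : (basisSpace hB).𝔉 := ⟨{b}, b, rfl⟩

theorem basisSingleton_surjective : Function.Surjective (basisSingleton hB) := by
  rintro ⟨_, b, rfl⟩
  exact ⟨b, rfl⟩

theorem below_basisSingleton (a b : B) :
    (basisSpace hB).Below (basisSingleton hB a) (basisSingleton hB b) ↔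
      Approximates a.1 b.1 := by
  refine Iff.trans ?_ (mem_upperApprox_singleton (fun a b : B => Approximates a.1 b.1) a b)
  constructor
  · exact fun h => h (Finset.mem_singleton_self a)
  · intro h x hx
    obtain rfl : x = a := Finset.mem_singleton.1 hx
    exact h

/-- The rounded ideal of the basis elements approximating `x`. -/
def approximants (x : D.carrier) : CFSpace.RoundedIdeal (basisSpace hB) where
  mems := basisSingleton hB '' {b | Approximates b.1 x}
  nonempty := by
    obtain ⟨b, hb, h⟩ := hB.exists_approximates x
    exact ⟨_, ⟨b, hb⟩, h, rfl⟩
  lower := by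
    rintro F _ h ⟨b, hb, rfl⟩
    obtain ⟨a, rfl⟩ := basisSingleton_surjective hB F
    exact ⟨a, ((below_basisSingleton hB a b).1 h).mono le_rfl hb.le, rfl⟩
  directed := by
    rintro _ ⟨a, ha, rfl⟩ _ ⟨b, hb, rfl⟩
    -- An upper bound `c` of `a` and `b` gives only `a ≤ c`; interpolating before taking the bound
    -- gives `a ≪ a' ≤ c`.
    obtain ⟨a', -, haa', ha'⟩ := hB.exists_between ha
    obtain ⟨b', -, hbb', hb'⟩ := hB.exists_between hb
    obtain ⟨c, hc, hcx, h, h'⟩ := hB.exists_upper_bound ha' hb'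
    exact ⟨_, ⟨⟨c, hc⟩, hcx, rfl⟩, (below_basisSingleton hB _ _).2 (haa'.mono le_rfl h),
      (below_basisSingleton hB _ _).2 (hbb'.mono le_rfl h')⟩

theorem mem_approximants (x : D.carrier) (b : B) :
    basisSingleton hB b ∈ (approximants hB x).mems ↔ Approximates b.1 x := by
  constructor
  · rintro ⟨a, ha, h⟩
    obtain rfl : a = b := Finset.singleton_injective (congrArg Subtype.val h)
    exact ha
  · exact fun h => ⟨b, h, rfl⟩

theorem approximants_le_iff {x y : D.carrier} :
    approximants hB x ≤ approximants hB y ↔ x ≤ y := by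
  constructor
  · intro h
    exact hB.le_of_forall fun b hb hbx =>
      ((mem_approximants hB y ⟨b, hb⟩).1 (h ((mem_approximants hB x ⟨b, hb⟩).2 hbx))).le
  · rintro h _ ⟨b, hb, rfl⟩
    exact ⟨b, hb.mono le_rfl h, rfl⟩

/-- The preimage of `I` is the supremum `x` of the basis elements occurring in `I`. If `b ≪ x`, then
`b ≤ c` for some such `c`, and roundedness supplies `d` in `I` with `c ≪ d`, hence `b ≪ d`. -/
theorem approximants_surjective : Function.Surjective (approximants hB) := by
  intro I
  let S : Set D.carrier := Subtype.val '' {b : B | basisSingleton hB b ∈ I.mems}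
  have hne : S.Nonempty := by
    obtain ⟨F, hF⟩ := I.nonempty
    obtain ⟨b, rfl⟩ := basisSingleton_surjective hB F
    exact ⟨_, b, hF, rfl⟩
  have hdir : DirectedOn (· ≤ ·) S := by
    rintro _ ⟨a, ha, rfl⟩ _ ⟨b, hb, rfl⟩
    obtain ⟨F, hF, h, h'⟩ := I.directed _ ha _ hb
    obtain ⟨c, rfl⟩ := basisSingleton_surjective hB F
    exact ⟨_, ⟨c, hF, rfl⟩, ((below_basisSingleton hB a c).1 h).le,
      ((below_basisSingleton hB b c).1 h').le⟩
  obtain ⟨x, hx⟩ := D.directedComplete S hne hdir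
  refine ⟨x, CFSpace.RoundedIdeal.mems_injective (Set.ext fun F => ?_)⟩
  obtain ⟨b, rfl⟩ := basisSingleton_surjective hB F
  rw [mem_approximants]
  constructor
  · intro hb
    obtain ⟨_, ⟨c, hc, rfl⟩, hbc⟩ := hb S hne hdir x hx le_rfl
    obtain ⟨F, hF, h⟩ := I.exists_above hc
    obtain ⟨d, rfl⟩ := basisSingleton_surjective hB F
    exact I.lower _ _ ((below_basisSingleton hB b d).2
      (((below_basisSingleton hB c d).1 h).mono hbc le_rfl)) hF
  · intro hb
    obtain ⟨F, hF, h⟩ := I.exists_above hb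
    obtain ⟨c, rfl⟩ := basisSingleton_surjective hB F
    exact ((below_basisSingleton hB b c).1 h).mono le_rfl (hx.1 ⟨c, hF, rfl⟩)

/-- A domain is isomorphic to the domain of rounded ideals of any of its bases. -/
noncomputable def idealDomBasisSpaceIso : (basisSpace hB).idealDom ≅ D :=
  isoOfOrderIso (E := D) (D := (basisSpace hB).idealDom) <| OrderIso.symm <|
    { Equiv.ofBijective (approximants hB)
        ⟨fun _ _ h => le_antisymm ((approximants_le_iff hB).1 h.le)
          ((approximants_le_iff hB).1 h.ge), approximants_surjective hB⟩ with
      map_rel_iff' := approximants_le_iff hB }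

theorem conditionM_basisSpace (hD : D.IsPointed) : (basisSpace hB).ConditionM := by
  obtain ⟨x, hx⟩ := hD
  -- Any basis element `b` with `b ≪ x`, for `x` least, approximates everything.
  obtain ⟨b, hb, hbx⟩ := hB.exists_approximates x
  refine ⟨basisSingleton hB ⟨b, hb⟩, fun F => ?_⟩
  obtain ⟨c, rfl⟩ := basisSingleton_surjective hB F
  exact (below_basisSingleton hB _ c).2 (hbx.mono le_rfl (hx c.1))

theorem isTopological_basisSpace
    (hD : IsDomainBasis {x : D.carrier | Approximates x x}) :
    (basisSpace hD).IsTopological :=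
  fun x => x.2

end Dom

/-- A fully faithful functor restricts to an equivalence between full subcategories that correspond
to each other up to isomorphism. -/
theorem CategoryTheory.Functor.nonempty_equivalence_fullSubcategory {C D : Type*} [Category* C]
    [Category* D] (Φ : C ⥤ D) [Φ.Full] [Φ.Faithful] (P : ObjectProperty C) (Q : ObjectProperty D)
    (h : ∀ X, P X → Q (Φ.obj X)) (h' : ∀ Y, Q Y → ∃ X, P X ∧ Nonempty (Φ.obj X ≅ Y)) :
    Nonempty (P.FullSubcategory ≌ Q.FullSubcategory) := by
  let Ψ : P.FullSubcategory ⥤ Q.FullSubcategory := Q.lift (P.ι ⋙ Φ) fun X => h _ X.2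
  have : Ψ.EssSurj := ⟨fun Y => by
    obtain ⟨X, hX, ⟨e⟩⟩ := h' Y.1 Y.2
    exact ⟨⟨X, hX⟩, ⟨Q.isoMk e⟩⟩⟩
  -- Fullness and faithfulness of `Ψ` are found by instance search from those of `Φ`.
  have : Ψ.IsEquivalence := {}
  exact ⟨Ψ.asEquivalence⟩

theorem mainTheorem3 :
    Nonempty (TCFA.{u} ≌ ADom.{u}) ∧
    Nonempty (CFAM.{u} ≌ PDom.{u}) ∧
    Nonempty (TCFAM.{u} ≌ APDom.{u}) := by
  refine ⟨CFSpace.idealFunctor.nonempty_equivalence_fullSubcategory _ _ ?_ ?_,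
    CFSpace.idealFunctor.nonempty_equivalence_fullSubcategory _ _ ?_ ?_,
    CFSpace.idealFunctor.nonempty_equivalence_fullSubcategory _ _ ?_ ?_⟩
  · exact fun U hU => CFSpace.isAlgebraic_idealDom hU
  · exact fun D hD =>
      ⟨Dom.basisSpace hD, Dom.isTopological_basisSpace hD, ⟨Dom.idealDomBasisSpaceIso hD⟩⟩
  · exact fun U hU => CFSpace.isPointed_idealDom hU
  -- Any basis works here, whereas the algebraic cases require the basis of compact elements to make
  -- the relation reflexive.
  · intro D hD
    obtain ⟨B, hB⟩ := D.exists_basis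
    exact ⟨Dom.basisSpace hB, Dom.conditionM_basisSpace hB hD, ⟨Dom.idealDomBasisSpaceIso hB⟩⟩
  · exact fun U hU => ⟨CFSpace.isAlgebraic_idealDom hU.1, CFSpace.isPointed_idealDom hU.2⟩
  · exact fun D hD => ⟨Dom.basisSpace hD.1,
      ⟨Dom.isTopological_basisSpace hD.1, Dom.conditionM_basisSpace hD.1 hD.2⟩,
      ⟨Dom.idealDomBasisSpaceIso hD.1⟩⟩
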